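/- Let $\mathcal R,\mathcal S,\mathcal T$ be small preadditive categories and let $\phi:\mathcal R\to\mathcal S$ and $\xi:\mathcal T\to\mathcal S$ be additive functors. For a small preadditive category $\mathcal A$, let $\mathcal M_{\mathcal A}$ be the category of right $\mathcal A$-modules, i.e. additive functors $\mathcal A^{op}\to\mathbf{Ab}$; left $\mathcal A$-modules are additive functors $\mathcal A\to\mathbf{Ab}$. Let $\phi_*:\mathcal M_{\mathcal S}\to\mathcal M_{\mathcal R}$ and $\xi_*:\mathcal M_{\mathcal S}\to\mathcal M_{\mathcal T}$ be the restrictions of scalars (precomposition with $\phi$, resp. $\xi$). For a right $\mathcal R$-module $M$ and a left $\mathcal R$-module $N$, put $M\otimes_{\mathcal R}N=\bigoplus_{b\in Ob(\mathcal R)}(M(b)\otimes_{\mathbb Z}N(b))/U$, where $U$ is the subgroup generated by the elements $M(r)(x)\otimes y-x\otimes N(r)(y)$ for $r\in\mathcal R(b,b')$, $x\in M(b')$, $y\in N(b)$. Functors $F:\mathcal C\to\mathcal D$ and $I:\mathcal C\to\mathcal X$ being given, $F$ is called heavily $I$-separable if there is a natural transformation $P:\mathcal D(F(-),F(-))\to\mathcal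 X(I(-),I(-))$ of functors $\mathcal C^{op}\times\mathcal C\to Set$ such that $P_{a,b}(F(u))=I(u)$ for all $u\in\mathcal C(a,b)$, and $P_{a,c}(k\circ h)=P_{b,c}(k)\circ P_{a,b}(h)$ for all objects $a,b,c$ of $\mathcal C$, $h\in\mathcal D(Fa,Fb)$ and $k\in\mathcal D(Fb,Fc)$. Theorem. The functor $\phi_*$ is heavily $\xi_*$-separable if and only if there is a family of elements, given by finite sums, $$\Gamma_a=\sum_{b\in Ob(\mathcal R)}\sum_i f_i^{ab}\otimes g_i^{ab}\in\mathcal S(\phi(-),\xi(a))\otimes_{\mathcal R}\mathcal S(\xi(a),\phi(-)),\qquad a\in Ob(\mathcal T),$$ with $f_i^{ab}\in\mathcal S(\phi(b),\xi(a))$ and $g_i^{ab}\in\mathcal S(\xi(a),\phi(b))$, satisfying the following conditions. (1) For all objects $a,c$ of $\mathcal T$ and every $t\in\mathcal T(c,a)$, $$\sum_b\sum_i(\xi(t)\circ f_i^{cb})\otimes g_i^{cb}=\sum_b\sum_i f_i^{ab}\otimes(g_i^{ab}\circ\xi(t))$$ in $\mathcal S(\phi(-),\xi(a))\otimes_{\mathcal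 R}\mathcal S(\xi(c),\phi(-))$. (2) For every object $a$ of $\mathcal T$, $\sum_b\sum_i f_i^{ab}\circ g_i^{ab}=1_{\xi(a)}$. (3) For every object $a$ of $\mathcal T$, $$\sum_d\sum_k\Big(\sum_b\sum_i f_i^{ab}\otimes(g_i^{ab}\circ f_k^{ad})\Big)\otimes g_k^{ad}=\sum_b\sum_i\big(f_i^{ab}\otimes 1_{\phi(b)}\big)\otimes g_i^{ab}$$ in $\big(\mathcal S(\phi(-),\xi(a))\otimes_{\mathcal R}\mathcal S(\phi(\ast),\phi(-))\big)\otimes_{\mathcal R}\mathcal S(\xi(a),\phi(\ast))$, where the inner tensor product is taken over the variable $-$ and the outer one over the variable $\ast$. -/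

import Mathlib

open CategoryTheory Opposite
open scoped TensorProduct DirectSum

universe u

/-! ### Heavily separable functors of the second kind -/

namespace HeavySep

noncomputable section

section Separability

universe v₁ v₂ v₃ u₁ u₂ u₃

variable {C : Type u₁} [Category.{v₁} C] {D : Type u₂} [Category.{v₂} D]
  {X : Type u₃} [Category.{v₃} X]

/-- A natural transformation `P : D(F -, F -) ⟶ X(I -, I -)` of set-valued functors on `Cᵒᵖ × C`
(written out on components, so that `D` and `X` may have hom-sets in different universes)
with `P (F f) = I f` and compatible with composition. -/
structure HeavySplitting (F : C ⥤ D) (I : C ⥤ X) where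
  /-- the components of the transformation -/
  app (a b : C) : (F.obj a ⟶ F.obj b) → (I.obj a ⟶ I.obj b)
  /-- naturality on `Cᵒᵖ × C` -/
  naturality {a a' b b' : C} (f : a' ⟶ a) (g : b ⟶ b') (h : F.obj a ⟶ F.obj b) :
    app a' b' (F.map f ≫ h ≫ F.map g) = I.map f ≫ app a b h ≫ I.map g
  /-- `P` splits `F` up to `I` -/
  app_map {a b : C} (f : a ⟶ b) : app a b (F.map f) = I.map f
  /-- compatibility with composition -/
  app_comp {a b c : C} (h : F.obj a ⟶ F.obj b) (k : F.obj b ⟶ F.obj c) :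
    app a c (h ≫ k) = app a b h ≫ app b c k

/-- `F` is heavily `I`-separable. -/
def IsHeavilySeparable (F : C ⥤ D) (I : C ⥤ X) : Prop :=
  Nonempty (HeavySplitting F I)

end Separability

/-! ### Modules over a small preadditive category -/

/-- Right `R`-modules: additive functors `Rᵒᵖ ⥤ Ab`. -/
abbrev RightMod (R : Type u) [SmallCategory R] [Preadditive R] :=
  Rᵒᵖ ⥤+ AddCommGrpCat.{u}

/-- Left `R`-modules: additive functors `R ⥤ Ab`. -/
abbrev LeftMod (R : Type u) [SmallCategory R] [Preadditive R] :=
  R ⥤+ AddCommGrpCat.{u}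

variable {R S : Type u} [SmallCategory R] [Preadditive R] [SmallCategory S] [Preadditive S]

/-- Restriction of scalars `φ_*` on right modules: precomposition with `φᵒᵖ`. -/
def restrictScalars (φ : R ⥤ S) [φ.Additive] : RightMod S ⥤ RightMod R :=
  (additiveFunctor Rᵒᵖ AddCommGrpCat.{u}).lift
    (AdditiveFunctor.forget Sᵒᵖ AddCommGrpCat.{u} ⋙
      (Functor.whiskeringLeft Rᵒᵖ Sᵒᵖ AddCommGrpCat.{u}).obj φ.op)
    (fun M => (inferInstance : (φ.op ⋙ M.obj).Additive))

/-- The right `S`-module `H_x = S(-, x)`. -/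
def rightHom (x : S) : RightMod S where
  obj :=
    { obj := fun s => AddCommGrpCat.of (s.unop ⟶ x)
      map := fun h => AddCommGrpCat.ofHom (Preadditive.leftComp x h.unop)
      map_id := fun _ => AddCommGrpCat.hom_ext <| AddMonoidHom.ext fun f => Category.id_comp f
      map_comp := fun h k => AddCommGrpCat.hom_ext <| AddMonoidHom.ext fun f =>
        Category.assoc k.unop h.unop f }
  property :=
    { map_add := fun {s s'} h k => AddCommGrpCat.hom_ext <| AddMonoidHom.ext fun f =>
        Preadditive.add_comp (unop s') (unop s) x h.unop k.unop f }

/-- The left `R`-module `S(y, φ -)`. -/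
def leftHom (φ : R ⥤ S) [φ.Additive] (y : S) : LeftMod R where
  obj :=
    { obj := fun r => AddCommGrpCat.of (y ⟶ φ.obj r)
      map := fun h => AddCommGrpCat.ofHom (Preadditive.rightComp y (φ.map h))
      map_id := fun r => AddCommGrpCat.hom_ext <| AddMonoidHom.ext fun f =>
        (congrArg (f ≫ ·) (φ.map_id r)).trans (Category.comp_id f)
      map_comp := fun h k => AddCommGrpCat.hom_ext <| AddMonoidHom.ext fun f =>
        (congrArg (f ≫ ·) (φ.map_comp h k)).trans (Category.assoc f (φ.map h) (φ.map k)).symm }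
  property :=
    { map_add := fun {r r'} h k => AddCommGrpCat.hom_ext <| AddMonoidHom.ext fun f =>
        (congrArg (f ≫ ·) φ.map_add).trans
          (Preadditive.comp_add y (φ.obj r) (φ.obj r') f (φ.map h) (φ.map k)) }

/-- Precomposition with `h : y' ⟶ y`, as a map of left `R`-modules `S(y, φ -) ⟶ S(y', φ -)`. -/
def leftHomMap (φ : R ⥤ S) [φ.Additive] {y' y : S} (h : y' ⟶ y) :
    leftHom φ y ⟶ leftHom φ y' :=
  ObjectProperty.homMk
    { app := fun r => AddCommGrpCat.ofHom (Preadditive.leftComp (φ.obj r) h)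
      naturality := fun _ _ k => AddCommGrpCat.hom_ext <| AddMonoidHom.ext fun f =>
        (Category.assoc h f (φ.map k)).symm }

/-! ### The tensor product over a small preadditive category -/

section Tensor

open Classical in
/-- The subgroup of `⨁ a, M(a) ⊗ N(a)` generated by the `M(r)(x) ⊗ y - x ⊗ N(r)(y)`
for `r : a ⟶ b`, `x ∈ M(b)`, `y ∈ N(a)`. -/
def tensorRel (M : RightMod R) (N : LeftMod R) :
    AddSubgroup (⨁ a : R, (M.obj.obj (op a) ⊗[ℤ] N.obj.obj a)) :=
  AddSubgroup.closure
    {z | ∃ (a b : R) (r : a ⟶ b) (x : M.obj.obj (op b)) (y : N.obj.obj a),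
      z = DirectSum.of (fun a : R => M.obj.obj (op a) ⊗[ℤ] N.obj.obj a) a
            (M.obj.map r.op x ⊗ₜ[ℤ] y)
          - DirectSum.of (fun a : R => M.obj.obj (op a) ⊗[ℤ] N.obj.obj a) b
            (x ⊗ₜ[ℤ] N.obj.map r y)}

/-- The tensor product `M ⊗_R N`. -/
abbrev Tensor (M : RightMod R) (N : LeftMod R) : Type u :=
  (⨁ a : R, (M.obj.obj (op a) ⊗[ℤ] N.obj.obj a)) ⧸ tensorRel M N

open Classical in
/-- The canonical map `M(b) ⊗ N(b) → M ⊗_R N`. -/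
def Tensor.incl (M : RightMod R) (N : LeftMod R) (b : R) :
    (M.obj.obj (op b) ⊗[ℤ] N.obj.obj b) →+ Tensor M N :=
  (QuotientAddGroup.mk' (tensorRel M N)).comp
    (DirectSum.of (fun a : R => M.obj.obj (op a) ⊗[ℤ] N.obj.obj a) b)

/-- The class `x ⊗ y` in `M ⊗_R N`, for `x ∈ M(b)` and `y ∈ N(b)`. -/
def Tensor.tmul (M : RightMod R) (N : LeftMod R) (b : R)
    (x : M.obj.obj (op b)) (y : N.obj.obj b) : Tensor M N :=
  Tensor.incl M N b (x ⊗ₜ[ℤ] y)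

theorem Tensor.tmul_map (M : RightMod R) (N : LeftMod R) {a b : R} (r : a ⟶ b)
    (x : M.obj.obj (op b)) (y : N.obj.obj a) :
    Tensor.tmul M N a (M.obj.map r.op x) y = Tensor.tmul M N b x (N.obj.map r y) := by
  classical
  rw [← sub_eq_zero]
  change QuotientAddGroup.mk' _ _ - QuotientAddGroup.mk' _ _ = _
  rw [← map_sub]
  refine (QuotientAddGroup.eq_zero_iff _).2 (AddSubgroup.subset_closure ?_)
  exact ⟨a, b, r, x, y, by congr!⟩

theorem Tensor.addHom_ext {M : RightMod R} {N : LeftMod R} {A : Type*} [AddCommGroup A]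
    {p q : Tensor M N →+ A}
    (h : ∀ b x y, p (Tensor.tmul M N b x y) = q (Tensor.tmul M N b x y)) : p = q := by
  classical
  apply QuotientAddGroup.addMonoidHom_ext
  apply DirectSum.addHom_ext
  intro b t
  induction t using TensorProduct.induction_on with
  | zero => simp
  | tmul x y => exact h b x y
  | add s t hs ht => rw [map_add, map_add, map_add, hs, ht]

open Classical in
/-- The map `M ⊗_R N → M ⊗_R N'`, `x ⊗ y ↦ x ⊗ α(y)`, induced by `α : N ⟶ N'`. -/
def Tensor.mapRight (M : RightMod R) {N N' : LeftMod R} (α : N ⟶ N') :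
    Tensor M N →+ Tensor M N' :=
  QuotientAddGroup.lift (tensorRel M N)
    (DirectSum.toAddMonoid fun b => (Tensor.incl M N' b).comp
      (TensorProduct.map LinearMap.id (α.hom.app b).hom.toIntLinearMap).toAddMonoidHom)
    (by
      rw [tensorRel, AddSubgroup.closure_le]
      rintro _ ⟨a, b, r, x, y, rfl⟩
      have hn : α.hom.app b (N.obj.map r y) = N'.obj.map r (α.hom.app a y) :=
        ConcreteCategory.congr_hom (α.hom.naturality r) y
      have key := Tensor.tmul_map M N' r x (α.hom.app a y)
      rw [← hn] at key
      simp only [SetLike.mem_coe, AddMonoidHom.mem_ker, map_sub, DirectSum.toAddMonoid_of]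
      exact sub_eq_zero.2 key)

theorem Tensor.mapRight_tmul (M : RightMod R) {N N' : LeftMod R} (α : N ⟶ N') (b : R)
    (x : M.obj.obj (op b)) (y : N.obj.obj b) :
    Tensor.mapRight M α (Tensor.tmul M N b x y) = Tensor.tmul M N' b x (α.hom.app b y) := by
  classical
  exact DirectSum.toAddMonoid_of (β := fun a : R => M.obj.obj (op a) ⊗[ℤ] N.obj.obj a)
    (fun b => (Tensor.incl M N' b).comp
      (TensorProduct.map LinearMap.id (α.hom.app b).hom.toIntLinearMap).toAddMonoidHom)
    b (x ⊗ₜ[ℤ] y)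

theorem Tensor.tmul_add (M : RightMod R) (N : LeftMod R) (b : R)
    (x : M.obj.obj (op b)) (y y' : N.obj.obj b) :
    Tensor.tmul M N b x (y + y') = Tensor.tmul M N b x y + Tensor.tmul M N b x y' := by
  simp [Tensor.tmul, TensorProduct.tmul_add]

end Tensor

/-- Extension of scalars `φ^* M = M ⊗_R S(-, φ -)`, as a right `S`-module. -/
def extendScalarsObj (φ : R ⥤ S) [φ.Additive] (M : RightMod R) : RightMod S where
  obj :=
    { obj := fun s => AddCommGrpCat.of (Tensor M (leftHom φ s.unop))
      map := fun h => AddCommGrpCat.ofHom (Tensor.mapRight M (leftHomMap φ h.unop))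
      map_id := by
        intro s
        apply AddCommGrpCat.hom_ext
        apply Tensor.addHom_ext
        intro b x y
        refine (Tensor.mapRight_tmul M _ b x y).trans ?_
        exact congrArg (Tensor.tmul M _ b x) (Category.id_comp (X := unop s) y)
      map_comp := by
        intro s s' s'' h k
        apply AddCommGrpCat.hom_ext
        apply Tensor.addHom_ext
        intro b x y
        refine (Tensor.mapRight_tmul M _ b x y).trans ?_
        refine Eq.trans ?_ (congrArg (Tensor.mapRight M (leftHomMap φ k.unop))
          (Tensor.mapRight_tmul M (leftHomMap φ h.unop) b x y)).symm
        refine Eq.trans ?_ (Tensor.mapRight_tmul M (leftHomMap φ k.unop) b x _).symm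
        exact congrArg (Tensor.tmul M _ b x)
          (Category.assoc (W := unop s'') k.unop h.unop y) }
  property := by
    refine Functor.Additive.mk ?_
    intro s s' h k
    apply AddCommGrpCat.hom_ext
    apply Tensor.addHom_ext
    intro b x y
    refine (Tensor.mapRight_tmul M _ b x y).trans ?_
    refine Eq.trans ?_ (congrArg₂ (· + ·) (Tensor.mapRight_tmul M (leftHomMap φ h.unop) b x y)
      (Tensor.mapRight_tmul M (leftHomMap φ k.unop) b x y)).symm
    refine Eq.trans ?_ (Tensor.tmul_add M _ b x _ _)
    exact congrArg (Tensor.tmul M _ b x)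
      (Preadditive.add_comp (unop s') (unop s) _ h.unop k.unop y)

/-! ### The tensor products in which the three conditions are stated -/

/-- `S(φ -, x) ⊗_R S(y, φ -)`. -/
abbrev HomTensor (φ : R ⥤ S) [φ.Additive] (x y : S) : Type u :=
  Tensor ((restrictScalars φ).obj (rightHom x)) (leftHom φ y)

/-- `f ⊗ g ∈ S(φ -, x) ⊗_R S(y, φ -)`. -/
def homTmul (φ : R ⥤ S) [φ.Additive] {x y : S} {b : R}
    (f : φ.obj b ⟶ x) (g : y ⟶ φ.obj b) : HomTensor φ x y :=
  Tensor.tmul ((restrictScalars φ).obj (rightHom x)) (leftHom φ y) b f g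

/-- `(S(φ -, x) ⊗_R S(φ *, φ -)) ⊗_R S(y, φ *)`, the outer tensor product being taken over
the variable `*`; its first factor is the right `R`-module `φ_* φ^* φ_* H_x`. -/
abbrev HomTensor₃ (φ : R ⥤ S) [φ.Additive] (x y : S) : Type u :=
  Tensor
    ((restrictScalars φ).obj (extendScalarsObj φ ((restrictScalars φ).obj (rightHom x))))
    (leftHom φ y)

/-- `w ⊗ g` for `w ∈ S(φ -, x) ⊗_R S(φ d, φ -)` and `g ∈ S(y, φ d)`. -/
def homTmul₃ (φ : R ⥤ S) [φ.Additive] {x y : S} {d : R}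
    (w : HomTensor φ x (φ.obj d)) (g : y ⟶ φ.obj d) : HomTensor₃ φ x y :=
  Tensor.tmul
    ((restrictScalars φ).obj (extendScalarsObj φ ((restrictScalars φ).obj (rightHom x))))
    (leftHom φ y) d w g

end

end HeavySep

namespace HeavySep

noncomputable section

variable {R S T : Type u} [SmallCategory R] [Preadditive R]
    [SmallCategory S] [Preadditive S] [SmallCategory T] [Preadditive T]

/-! Extension of scalars `φ^*` supplies a unit `η : M ⟶ φ_* φ^* M`, and `P` is determined by its
values on these units: a heavy splitting is encoded by the elements `Γ_a = P(η)(1)`, where `η` is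
the unit at `φ_* H_{ξ a}`.

Given `P`, Yoneda and naturality of `η` express `P(η)` at any element of any module through `Γ_a`
(`splitting_extendUnit`). Naturality of `P(η)` along `t` is then condition (1). The triangle
identity for `η` and the counit `f ⊗ g ↦ f ∘ g` gives (2), since `P` sends `φ_* α` to `ξ_* α`. The
composite of two successive units equals `η` followed by `φ_* φ^* η`; multiplicativity of `P` on it
is (3).

Given `Γ`, set `P(h)_a = ∑ N(g) ∘ h ∘ M(f)`. This is well defined on tensors because `h` is
`R`-linear. Condition (1) makes `P(h)` a map of `T`-modules, (2) gives `P(φ_* α) = ξ_* α`, and (3),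
evaluated on a pair `h`, `k`, gives compatibility with composition (`evalHom_comp_of_heavy`).
Naturality of `P` needs no condition. -/

/-! ### Tensor products over `R`: maps out of them and finite sums of pure tensors. -/

open Classical in
/-- The additive map out of `M ⊗_R N` induced by a balanced family of biadditive maps. -/
def Tensor.lift {M : RightMod R} {N : LeftMod R} {A : Type*} [AddCommGroup A]
    (F : ∀ b : R, M.obj.obj (op b) →+ N.obj.obj b →+ A)
    (hF : ∀ (a b : R) (r : a ⟶ b) (x : M.obj.obj (op b)) (y : N.obj.obj a),
      F a (M.obj.map r.op x) y = F b x (N.obj.map r y)) : Tensor M N →+ A :=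
  QuotientAddGroup.lift (tensorRel M N)
    (DirectSum.toAddMonoid fun b => TensorProduct.liftAddHom (F b) (fun n x y => by simp))
    (by
      rw [tensorRel, AddSubgroup.closure_le]
      rintro _ ⟨a, b, r, x, y, rfl⟩
      simp only [SetLike.mem_coe, AddMonoidHom.mem_ker, map_sub, DirectSum.toAddMonoid_of]
      exact sub_eq_zero.2 (hF a b r x y))

theorem Tensor.lift_tmul {M : RightMod R} {N : LeftMod R} {A : Type*} [AddCommGroup A]
    (F : ∀ b : R, M.obj.obj (op b) →+ N.obj.obj b →+ A)
    (hF : ∀ (a b : R) (r : a ⟶ b) (x : M.obj.obj (op b)) (y : N.obj.obj a),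
      F a (M.obj.map r.op x) y = F b x (N.obj.map r y)) (b : R)
    (x : M.obj.obj (op b)) (y : N.obj.obj b) :
    Tensor.lift F hF (Tensor.tmul M N b x y) = F b x y := by
  classical
  exact DirectSum.toAddMonoid_of (β := fun a : R => M.obj.obj (op a) ⊗[ℤ] N.obj.obj a)
    (fun b => TensorProduct.liftAddHom (F b) (fun n x y => by simp)) b (x ⊗ₜ[ℤ] y)

theorem Tensor.add_tmul (M : RightMod R) (N : LeftMod R) (b : R)
    (x x' : M.obj.obj (op b)) (y : N.obj.obj b) :
    Tensor.tmul M N b (x + x') y = Tensor.tmul M N b x y + Tensor.tmul M N b x' y := by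
  simp [Tensor.tmul, TensorProduct.add_tmul]

/-- The map `M ⊗_R N → M' ⊗_R N`, `x ⊗ y ↦ α(x) ⊗ y`, induced by `α : M ⟶ M'`. -/
def Tensor.mapLeft {M M' : RightMod R} (N : LeftMod R) (α : M ⟶ M') :
    Tensor M N →+ Tensor M' N :=
  Tensor.lift
    (fun b => AddMonoidHom.mk' (fun x => AddMonoidHom.mk'
        (fun y => Tensor.tmul M' N b (α.hom.app (op b) x) y)
        (fun y y' => Tensor.tmul_add M' N b _ y y'))
      (fun x x' => AddMonoidHom.ext fun y =>
        (congrArg (fun z => Tensor.tmul M' N b z y) (map_add (α.hom.app (op b)).hom x x')).trans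
          (Tensor.add_tmul M' N b _ _ y)))
    (fun a b r x y =>
      (congrArg (fun z => Tensor.tmul M' N a z y)
        (ConcreteCategory.congr_hom (α.hom.naturality r.op) x)).trans
        (Tensor.tmul_map M' N r (α.hom.app (op b) x) y))

theorem Tensor.mapLeft_tmul {M M' : RightMod R} (N : LeftMod R) (α : M ⟶ M') (b : R)
    (x : M.obj.obj (op b)) (y : N.obj.obj b) :
    Tensor.mapLeft N α (Tensor.tmul M N b x y) = Tensor.tmul M' N b (α.hom.app (op b) x) y :=
  Tensor.lift_tmul _ _ b x y

/-- Every element of `M ⊗_R N` is a finite sum of classes `x ⊗ y`. -/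
theorem Tensor.exists_eq_sum {M : RightMod R} {N : LeftMod R} (w : Tensor M N) :
    ∃ (B : Finset R) (n : R → ℕ) (x : ∀ b, Fin (n b) → M.obj.obj (op b))
      (y : ∀ b, Fin (n b) → N.obj.obj b),
      w = ∑ b ∈ B, ∑ i, Tensor.tmul M N b (x b i) (y b i) := by
  classical
  obtain ⟨d, rfl⟩ := QuotientAddGroup.mk'_surjective (tensorRel M N) w
  have h : ∀ b, ∃ (n : ℕ) (x : Fin n → M.obj.obj (op b)) (y : Fin n → N.obj.obj b),
      d b = ∑ i, x i ⊗ₜ[ℤ] y i := by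
    intro b
    obtain ⟨s, hs⟩ := TensorProduct.exists_finset (d b)
    refine ⟨s.card, fun i => (s.equivFin.symm i).1.1, fun i => (s.equivFin.symm i).1.2, ?_⟩
    rw [hs, ← Finset.sum_coe_sort]
    exact (Equiv.sum_comp s.equivFin.symm fun p : s => p.1.1 ⊗ₜ[ℤ] p.1.2).symm
  choose n x y hxy using h
  refine ⟨DFinsupp.support d, n, x, y, ?_⟩
  conv_lhs => rw [← DirectSum.sum_support_of d]
  rw [map_sum]
  refine Finset.sum_congr rfl fun b _ => ?_
  rw [hxy, map_sum, map_sum]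
  exact Finset.sum_congr rfl fun i _ => by congr!

/-! ### Functoriality and unit of extension of scalars. -/

/-- Extension of scalars on morphisms. -/
def extendScalarsMap (φ : R ⥤ S) [φ.Additive] {M M' : RightMod R} (α : M ⟶ M') :
    extendScalarsObj φ M ⟶ extendScalarsObj φ M' :=
  ObjectProperty.homMk
    { app := fun s => AddCommGrpCat.ofHom (Tensor.mapLeft (leftHom φ s.unop) α)
      naturality := fun s s' h => by
        apply AddCommGrpCat.hom_ext
        apply Tensor.addHom_ext
        intro b x y
        refine (congrArg (Tensor.mapLeft (leftHom φ s'.unop) α)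
          (Tensor.mapRight_tmul M (leftHomMap φ h.unop) b x y)).trans ?_
        refine (Tensor.mapLeft_tmul _ α b x _).trans ?_
        refine Eq.trans ?_ (congrArg (Tensor.mapRight M' (leftHomMap φ h.unop))
          (Tensor.mapLeft_tmul (leftHom φ s.unop) α b x y)).symm
        exact (Tensor.mapRight_tmul M' (leftHomMap φ h.unop) b _ y).symm }

/-- The unit `M ⟶ φ_* φ^* M`, `x ↦ x ⊗ 1`. -/
def extendUnit (φ : R ⥤ S) [φ.Additive] (M : RightMod R) :
    M ⟶ (restrictScalars φ).obj (extendScalarsObj φ M) :=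
  ObjectProperty.homMk
    { app := fun b => AddCommGrpCat.ofHom (AddMonoidHom.mk'
        (fun x : M.obj.obj (op b.unop) =>
          Tensor.tmul M (leftHom φ (φ.obj b.unop)) b.unop x (𝟙 (φ.obj b.unop)))
        (fun x x' => Tensor.add_tmul M _ b.unop x x' _))
      naturality := fun b b' r => by
        apply AddCommGrpCat.hom_ext
        ext x
        -- The relation `x r ⊗ 1 = x ⊗ φ(r)` is exactly the linearity of `x ↦ x ⊗ 1`.
        refine (Tensor.tmul_map M (leftHom φ (φ.obj b'.unop)) r.unop x
          (𝟙 (φ.obj b'.unop))).trans ?_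
        refine Eq.trans ?_ (Tensor.mapRight_tmul M (leftHomMap φ (φ.map r.unop)) b.unop x
          (𝟙 (φ.obj b.unop))).symm
        exact congrArg (Tensor.tmul M (leftHom φ (φ.obj b'.unop)) b.unop x)
          ((Category.id_comp (φ.map r.unop)).trans (Category.comp_id (φ.map r.unop)).symm) }

/-! ### Evaluating tensors on `R`-linear maps. -/

/-- For `k : φ_* M ⟶ φ_* N`, the biadditive map `(f, g) ↦ N(g) ∘ k ∘ M(f)`. -/
def evalBiadditive (φ : R ⥤ S) [φ.Additive] {M N : RightMod S}
    (k : (restrictScalars φ).obj M ⟶ (restrictScalars φ).obj N) (x y : S) (b : R) :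
    (φ.obj b ⟶ x) →+ (y ⟶ φ.obj b) →+ (M.obj.obj (op x) →+ N.obj.obj (op y)) :=
  AddMonoidHom.mk' (fun f => AddMonoidHom.mk'
      (fun g => (N.obj.map g.op).hom.comp ((k.hom.app (op b)).hom.comp (M.obj.map f.op).hom))
      (fun g g' => by
        have := N.property
        ext m
        exact ConcreteCategory.congr_hom (N.obj.map_add (f := g.op) (g := g'.op)) _))
    (fun f f' => by
      have := M.property
      ext g m
      refine (congrArg (fun z => N.obj.map g.op (k.hom.app (op b) z))
        (ConcreteCategory.congr_hom (M.obj.map_add (f := f.op) (g := f'.op)) m)).trans ?_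
      exact (congrArg (N.obj.map g.op) (map_add (k.hom.app (op b)).hom _ _)).trans
        (map_add (N.obj.map g.op).hom _ _))

/-- Moving `φ(r)` from one side of `k` to the other is naturality of `k` at `r`. This is the only
linearity `k` has, so the tensor product has to be taken over `R`. -/
theorem evalBiadditive_balanced (φ : R ⥤ S) [φ.Additive] {M N : RightMod S}
    (k : (restrictScalars φ).obj M ⟶ (restrictScalars φ).obj N) (x y : S) {a b : R} (r : a ⟶ b)
    (f : φ.obj b ⟶ x) (g : y ⟶ φ.obj a) :
    evalBiadditive φ k x y a (φ.map r ≫ f) g = evalBiadditive φ k x y b f (g ≫ φ.map r) := by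
  ext m
  have h1 := ConcreteCategory.congr_hom (M.obj.map_comp f.op (φ.map r).op) m
  have h2 := ConcreteCategory.congr_hom (k.hom.naturality r.op) (M.obj.map f.op m)
  have h3 := ConcreteCategory.congr_hom (N.obj.map_comp (φ.map r).op g.op)
    (k.hom.app (op b) (M.obj.map f.op m))
  refine (congrArg (fun z => N.obj.map g.op (k.hom.app (op a) z)) h1).trans ?_
  exact (congrArg (N.obj.map g.op) h2).trans h3.symm

/-- For `k : φ_* M ⟶ φ_* N`, the additive map
`S(φ -, x) ⊗_R S(y, φ -) → Hom(M x, N y)`, `f ⊗ g ↦ N(g) ∘ k ∘ M(f)`. -/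
def evalHom (φ : R ⥤ S) [φ.Additive] {M N : RightMod S}
    (k : (restrictScalars φ).obj M ⟶ (restrictScalars φ).obj N) (x y : S) :
    HomTensor φ x y →+ (M.obj.obj (op x) →+ N.obj.obj (op y)) :=
  Tensor.lift (evalBiadditive φ k x y) (fun _ _ r f g => evalBiadditive_balanced φ k x y r f g)

theorem evalHom_homTmul (φ : R ⥤ S) [φ.Additive] {M N : RightMod S}
    (k : (restrictScalars φ).obj M ⟶ (restrictScalars φ).obj N) {x y : S} {b : R}
    (f : φ.obj b ⟶ x) (g : y ⟶ φ.obj b) (m : M.obj.obj (op x)) :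
    evalHom φ k x y (homTmul φ f g) m =
      N.obj.map g.op (k.hom.app (op b) (M.obj.map f.op m)) :=
  DFunLike.congr_fun (Tensor.lift_tmul (M := (restrictScalars φ).obj (rightHom x))
    (N := leftHom φ y) (evalBiadditive φ k x y)
    (fun _ _ r f g => evalBiadditive_balanced φ k x y r f g) b f g) m

theorem evalHom_mapRight (φ : R ⥤ S) [φ.Additive] {M N : RightMod S}
    (k : (restrictScalars φ).obj M ⟶ (restrictScalars φ).obj N) {x y y' : S} (h : y' ⟶ y)
    (w : HomTensor φ x y) (m : M.obj.obj (op x)) :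
    evalHom φ k x y' (Tensor.mapRight _ (leftHomMap φ h) w) m =
      N.obj.map h.op (evalHom φ k x y w m) := by
  refine DFunLike.congr_fun (f := ((AddMonoidHom.eval m).comp (evalHom φ k x y')).comp
    (Tensor.mapRight ((restrictScalars φ).obj (rightHom x)) (leftHomMap φ h)))
    (g := (N.obj.map h.op).hom.comp ((AddMonoidHom.eval m).comp (evalHom φ k x y))) ?_ w
  apply Tensor.addHom_ext
  intro b f g
  refine (congrArg (fun z => evalHom φ k x y' z m)
    (Tensor.mapRight_tmul _ (leftHomMap φ h) b f g)).trans ?_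
  refine (evalHom_homTmul φ k (b := b) f (h ≫ g) m).trans ?_
  refine Eq.trans ?_ (congrArg (N.obj.map h.op) (evalHom_homTmul φ k (b := b) f g m)).symm
  exact ConcreteCategory.congr_hom (N.obj.map_comp (Quiver.Hom.op g) h.op) _

/-- For `h : φ_* M ⟶ φ_* N` and `k : φ_* N ⟶ φ_* L`, the biadditive map sending
`(f ⊗ u, g)` to `L(g) ∘ k ∘ N(u) ∘ h ∘ M(f)`. -/
def evalBiadditive₃ (φ : R ⥤ S) [φ.Additive] {M N L : RightMod S}
    (h : (restrictScalars φ).obj M ⟶ (restrictScalars φ).obj N)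
    (k : (restrictScalars φ).obj N ⟶ (restrictScalars φ).obj L) (x y : S) (d : R) :
    HomTensor φ x (φ.obj d) →+ (y ⟶ φ.obj d) →+ (M.obj.obj (op x) →+ L.obj.obj (op y)) :=
  AddMonoidHom.mk' (fun w => AddMonoidHom.mk'
      (fun g =>
        (L.obj.map g.op).hom.comp ((k.hom.app (op d)).hom.comp (evalHom φ h x (φ.obj d) w)))
      (fun g g' => by
        have := L.property
        ext m
        exact ConcreteCategory.congr_hom (L.obj.map_add (f := g.op) (g := g'.op)) _))
    (fun w w' => by
      ext g m
      refine (congrArg (fun z => L.obj.map g.op (k.hom.app (op d) z))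
        (DFunLike.congr_fun (map_add (evalHom φ h x (φ.obj d)) w w') m)).trans ?_
      exact (congrArg (L.obj.map g.op) (map_add (k.hom.app (op d)).hom _ _)).trans
        (map_add (L.obj.map g.op).hom _ _))

/-- An arrow `r` acts on the inner tensor by precomposing its second factor with `φ(r)`;
`evalHom_mapRight` turns this into the action on `N`, past which `k` commutes. -/
theorem evalBiadditive₃_balanced (φ : R ⥤ S) [φ.Additive] {M N L : RightMod S}
    (h : (restrictScalars φ).obj M ⟶ (restrictScalars φ).obj N)
    (k : (restrictScalars φ).obj N ⟶ (restrictScalars φ).obj L) (x y : S) {a b : R} (r : a ⟶ b)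
    (w : HomTensor φ x (φ.obj b)) (g : y ⟶ φ.obj a) :
    evalBiadditive₃ φ h k x y a (Tensor.mapRight _ (leftHomMap φ (φ.map r)) w) g =
      evalBiadditive₃ φ h k x y b w (g ≫ φ.map r) := by
  ext m
  have h1 := evalHom_mapRight φ h (φ.map r) w m
  have h2 := ConcreteCategory.congr_hom (k.hom.naturality r.op) (evalHom φ h x (φ.obj b) w m)
  have h3 := ConcreteCategory.congr_hom (L.obj.map_comp (φ.map r).op g.op)
    (k.hom.app (op b) (evalHom φ h x (φ.obj b) w m))
  refine (congrArg (fun z => L.obj.map g.op (k.hom.app (op a) z)) h1).trans ?_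
  exact (congrArg (L.obj.map g.op) h2).trans h3.symm

/-- For `h : φ_* M ⟶ φ_* N` and `k : φ_* N ⟶ φ_* L`, the additive map
`(f ⊗ u) ⊗ g ↦ L(g) ∘ k ∘ N(u) ∘ h ∘ M(f)`. -/
def evalHom₃ (φ : R ⥤ S) [φ.Additive] {M N L : RightMod S}
    (h : (restrictScalars φ).obj M ⟶ (restrictScalars φ).obj N)
    (k : (restrictScalars φ).obj N ⟶ (restrictScalars φ).obj L) (x y : S) :
    HomTensor₃ φ x y →+ (M.obj.obj (op x) →+ L.obj.obj (op y)) :=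
  Tensor.lift (evalBiadditive₃ φ h k x y)
    (fun _ _ r w g => evalBiadditive₃_balanced φ h k x y r w g)

theorem evalHom₃_homTmul₃ (φ : R ⥤ S) [φ.Additive] {M N L : RightMod S}
    (h : (restrictScalars φ).obj M ⟶ (restrictScalars φ).obj N)
    (k : (restrictScalars φ).obj N ⟶ (restrictScalars φ).obj L) {x y : S} {d : R}
    (w : HomTensor φ x (φ.obj d)) (g : y ⟶ φ.obj d) (m : M.obj.obj (op x)) :
    evalHom₃ φ h k x y (homTmul₃ φ w g) m =
      L.obj.map g.op (k.hom.app (op d) (evalHom φ h x (φ.obj d) w m)) :=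
  DFunLike.congr_fun (Tensor.lift_tmul
    (M := (restrictScalars φ).obj (extendScalarsObj φ ((restrictScalars φ).obj (rightHom x))))
    (N := leftHom φ y) (evalBiadditive₃ φ h k x y)
    (fun _ _ r w g => evalBiadditive₃_balanced φ h k x y r w g) d w g) m

/-! ### Naturality of the unit, Yoneda, and the counit on representable modules. -/

namespace HeavySplitting

universe v₁ v₂ v₃ u₁ u₂ u₃

variable {C : Type u₁} [Category.{v₁} C] {D : Type u₂} [Category.{v₂} D]
  {X : Type u₃} [Category.{v₃} X] {F : C ⥤ D} {I : C ⥤ X}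

theorem app_map_comp (P : HeavySplitting F I) {a a' b : C} (f : a' ⟶ a)
    (h : F.obj a ⟶ F.obj b) : P.app a' b (F.map f ≫ h) = I.map f ≫ P.app a b h := by
  rw [P.app_comp, P.app_map]

theorem app_comp_map (P : HeavySplitting F I) {a b b' : C} (h : F.obj a ⟶ F.obj b)
    (g : b ⟶ b') : P.app a b' (h ≫ F.map g) = P.app a b h ≫ I.map g := by
  rw [P.app_comp, P.app_map]

end HeavySplitting

theorem RightMod.congr_app {M N : RightMod R} {α β : M ⟶ N} (h : α = β) (b : R)
    (x : M.obj.obj (op b)) : α.hom.app (op b) x = β.hom.app (op b) x := by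
  rw [h]

theorem extendUnit_naturality (φ : R ⥤ S) [φ.Additive] {M M' : RightMod R} (α : M ⟶ M') :
    α ≫ extendUnit φ M' = extendUnit φ M ≫ (restrictScalars φ).map (extendScalarsMap φ α) := by
  apply ObjectProperty.hom_ext
  ext b x
  exact (Tensor.mapLeft_tmul (leftHom φ (φ.obj b.unop)) α b.unop x (𝟙 _)).symm

/-- The map `H_x ⟶ N` corresponding to `n ∈ N(x)` under the Yoneda lemma. -/
def rightHomDesc (N : RightMod S) {x : S} (n : N.obj.obj (op x)) : rightHom x ⟶ N :=
  ObjectProperty.homMk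
    { app := fun s => AddCommGrpCat.ofHom (AddMonoidHom.mk'
        (fun f : s.unop ⟶ x => N.obj.map f.op n)
        (fun f f' => by
          have := N.property
          exact ConcreteCategory.congr_hom (N.obj.map_add (f := f.op) (g := f'.op)) n))
      naturality := fun s s' h => by
        apply AddCommGrpCat.hom_ext
        ext f
        exact ConcreteCategory.congr_hom (N.obj.map_comp (Quiver.Hom.op f) h) n }

theorem rightHomDesc_id (N : RightMod S) {x : S} (n : N.obj.obj (op x)) :
    (rightHomDesc N n).hom.app (op x) (𝟙 x) = n :=
  ConcreteCategory.congr_hom (N.obj.map_id (op x)) n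

/-- The counit `φ^* φ_* H_x ⟶ H_x`, `f ⊗ g ↦ f ∘ g`. -/
def homCounit (φ : R ⥤ S) [φ.Additive] (x : S) :
    extendScalarsObj φ ((restrictScalars φ).obj (rightHom x)) ⟶ rightHom x :=
  ObjectProperty.homMk
    -- Evaluation on the identity of `φ_* H_x` at the element `1` yields `f ∘ g`, so balance and
    -- naturality come from `evalHom`.
    { app := fun s => AddCommGrpCat.ofHom
        ((AddMonoidHom.eval (𝟙 x : (rightHom x).obj.obj (op x))).comp
          (evalHom φ (𝟙 ((restrictScalars φ).obj (rightHom x))) x s.unop))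
      naturality := fun s s' h => by
        apply AddCommGrpCat.hom_ext
        ext w
        exact evalHom_mapRight φ (𝟙 ((restrictScalars φ).obj (rightHom x))) h.unop w (𝟙 x) }

theorem homCounit_homTmul (φ : R ⥤ S) [φ.Additive] {x y : S} {b : R}
    (f : φ.obj b ⟶ x) (g : y ⟶ φ.obj b) :
    (homCounit φ x).hom.app (op y) (homTmul φ f g) = g ≫ f := by
  refine (evalHom_homTmul φ (𝟙 ((restrictScalars φ).obj (rightHom x))) f g (𝟙 x)).trans ?_
  exact congrArg (g ≫ ·) (Category.comp_id f)

theorem extendUnit_homCounit (φ : R ⥤ S) [φ.Additive] (x : S) :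
    extendUnit φ ((restrictScalars φ).obj (rightHom x)) ≫
      (restrictScalars φ).map (homCounit φ x) = (restrictScalars φ).map (𝟙 (rightHom x)) := by
  apply ObjectProperty.hom_ext
  ext b f
  refine (homCounit_homTmul φ (b := b.unop) f (𝟙 (φ.obj b.unop))).trans ?_
  exact Category.id_comp _

/-! ### From a heavy splitting to a family of elements. -/

/-- The element `P(η)(1)` of `S(φ -, ξ a) ⊗_R S(ξ a, φ -)`. -/
def splittingElement {φ : R ⥤ S} [φ.Additive] {ξ : T ⥤ S} [ξ.Additive]
    (P : HeavySplitting (restrictScalars φ) (restrictScalars ξ)) (a : T) :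
    HomTensor φ (ξ.obj a) (ξ.obj a) :=
  (P.app (rightHom (ξ.obj a))
    (extendScalarsObj φ ((restrictScalars φ).obj (rightHom (ξ.obj a))))
    (extendUnit φ _)).hom.app (op a) (𝟙 (ξ.obj a))

section Splitting

variable {φ : R ⥤ S} [φ.Additive] {ξ : T ⥤ S} [ξ.Additive]
    (P : HeavySplitting (restrictScalars φ) (restrictScalars ξ))

/-- By Yoneda `n` is the image of `1` under a map `H_{ξ a} ⟶ N`; naturality of the unit and of `P`
along this map reduces the value at `n` to the universal one. -/
theorem splitting_extendUnit (N : RightMod S) (a : T) (n : N.obj.obj (op (ξ.obj a))) :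
    (P.app N (extendScalarsObj φ ((restrictScalars φ).obj N)) (extendUnit φ _)).hom.app (op a) n =
      Tensor.mapLeft (leftHom φ (ξ.obj a)) ((restrictScalars φ).map (rightHomDesc N n))
        (splittingElement P a) := by
  have h := P.app_map_comp (rightHomDesc N n) (extendUnit φ ((restrictScalars φ).obj N))
  rw [extendUnit_naturality, P.app_comp_map] at h
  have h' := RightMod.congr_app h a (𝟙 (ξ.obj a))
  refine (congrArg _ (rightHomDesc_id N n).symm).trans ?_
  exact h'.symm

/-- Condition (1): both sides compute `P(η)` at `ξ(t) = 1 · t`, the left by Yoneda, the right by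
`T`-linearity. -/
theorem splittingElement_naturality {c a : T} (t : c ⟶ a) :
    Tensor.mapLeft (leftHom φ (ξ.obj c))
        ((restrictScalars φ).map (rightHomDesc (rightHom (ξ.obj a)) (ξ.map t)))
        (splittingElement P c) =
      Tensor.mapRight _ (leftHomMap φ (ξ.map t)) (splittingElement P a) := by
  refine (splitting_extendUnit P (rightHom (ξ.obj a)) c (ξ.map t)).symm.trans ?_
  have h := ConcreteCategory.congr_hom ((P.app (rightHom (ξ.obj a))
    (extendScalarsObj φ ((restrictScalars φ).obj (rightHom (ξ.obj a))))
    (extendUnit φ _)).hom.naturality t.op) (𝟙 (ξ.obj a))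
  refine Eq.trans (congrArg _ ?_) h
  exact (Category.comp_id (ξ.map t)).symm

/-- Condition (2): apply `P` to the triangle identity and evaluate at `1`. -/
theorem homCounit_splittingElement (a : T) :
    (homCounit φ (ξ.obj a)).hom.app (op (ξ.obj a)) (splittingElement P a) = 𝟙 (ξ.obj a) := by
  have h := P.app_comp_map (extendUnit φ ((restrictScalars φ).obj (rightHom (ξ.obj a))))
    (homCounit φ (ξ.obj a))
  rw [extendUnit_homCounit, P.app_map] at h
  exact (RightMod.congr_app h a (𝟙 (ξ.obj a))).symm

/-- Condition (3) without coordinates. The left side is `P(η)` applied to `P(η)(1)`, hence the value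
at `1` of `P` on two successive units; by naturality of the unit the second may be replaced by `φ_*
φ^* η`, which `P` carries to `ξ_* φ^* η`. -/
theorem splittingElement_heavy (a : T) :
    Tensor.mapLeft (leftHom φ (ξ.obj a))
        ((restrictScalars φ).map (rightHomDesc
          (extendScalarsObj φ ((restrictScalars φ).obj (rightHom (ξ.obj a))))
          (splittingElement P a)))
        (splittingElement P a) =
      Tensor.mapLeft (leftHom φ (ξ.obj a))
        (extendUnit φ ((restrictScalars φ).obj (rightHom (ξ.obj a))))
        (splittingElement P a) := by
  refine (splitting_extendUnit P
    (extendScalarsObj φ ((restrictScalars φ).obj (rightHom (ξ.obj a)))) a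
    (splittingElement P a)).symm.trans ?_
  have h := P.app_comp (extendUnit φ ((restrictScalars φ).obj (rightHom (ξ.obj a))))
    (extendUnit φ ((restrictScalars φ).obj
      (extendScalarsObj φ ((restrictScalars φ).obj (rightHom (ξ.obj a))))))
  rw [extendUnit_naturality] at h
  have h' := (P.app_comp_map (extendUnit φ ((restrictScalars φ).obj (rightHom (ξ.obj a))))
    (extendScalarsMap φ (extendUnit φ ((restrictScalars φ).obj (rightHom (ξ.obj a)))))).symm.trans h
  exact (RightMod.congr_app h' a (𝟙 (ξ.obj a))).symm

end Splitting

/-! ### Translation into explicit finite sums. -/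

theorem HomTensor.exists_eq_sum {φ : R ⥤ S} [φ.Additive] {x y : S} (w : HomTensor φ x y) :
    ∃ (B : Finset R) (n : R → ℕ) (f : ∀ b : R, Fin (n b) → (φ.obj b ⟶ x))
      (g : ∀ b : R, Fin (n b) → (y ⟶ φ.obj b)),
      w = ∑ b ∈ B, ∑ i, homTmul φ (f b i) (g b i) :=
  Tensor.exists_eq_sum (M := (restrictScalars φ).obj (rightHom x)) (N := leftHom φ y) w

section Sums

variable {φ : R ⥤ S} [φ.Additive] {x y : S} (B : Finset R) {n : R → ℕ}
  (f : ∀ b : R, Fin (n b) → (φ.obj b ⟶ x)) (g : ∀ b : R, Fin (n b) → (y ⟶ φ.obj b))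

theorem mapLeft_sum_homTmul {M : RightMod R} (α : (restrictScalars φ).obj (rightHom x) ⟶ M) :
    Tensor.mapLeft (leftHom φ y) α (∑ b ∈ B, ∑ i, homTmul φ (f b i) (g b i)) =
      ∑ b ∈ B, ∑ i, Tensor.tmul M (leftHom φ y) b (α.hom.app (op b) (f b i)) (g b i) := by
  rw [map_sum]
  refine Finset.sum_congr rfl fun b _ => ?_
  rw [map_sum]
  exact Finset.sum_congr rfl fun i _ =>
    Tensor.mapLeft_tmul (M := (restrictScalars φ).obj (rightHom x)) (leftHom φ y) α b
      (f b i) (g b i)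

theorem mapRight_sum_homTmul {y' : S} (h : y' ⟶ y) :
    Tensor.mapRight ((restrictScalars φ).obj (rightHom x)) (leftHomMap φ h)
        (∑ b ∈ B, ∑ i, homTmul φ (f b i) (g b i)) =
      ∑ b ∈ B, ∑ i, homTmul φ (f b i) (h ≫ g b i) := by
  rw [map_sum]
  refine Finset.sum_congr rfl fun b _ => ?_
  rw [map_sum]
  exact Finset.sum_congr rfl fun i _ =>
    Tensor.mapRight_tmul ((restrictScalars φ).obj (rightHom x)) (leftHomMap φ h) b
      (f b i) (g b i)

theorem homCounit_sum_homTmul :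
    (homCounit φ x).hom.app (op y) (∑ b ∈ B, ∑ i, homTmul φ (f b i) (g b i)) =
      ∑ b ∈ B, ∑ i, (g b i ≫ f b i : y ⟶ x) := by
  refine (map_sum ((homCounit φ x).hom.app (op y)).hom _ _).trans ?_
  refine Finset.sum_congr rfl fun b _ => ?_
  refine (map_sum ((homCounit φ x).hom.app (op y)).hom _ _).trans ?_
  exact Finset.sum_congr rfl fun i _ => homCounit_homTmul φ (f b i) (g b i)

theorem evalHom_sum_homTmul {M N : RightMod S}
    (h : (restrictScalars φ).obj M ⟶ (restrictScalars φ).obj N) (m : M.obj.obj (op x)) :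
    evalHom φ h x y (∑ b ∈ B, ∑ i, homTmul φ (f b i) (g b i)) m =
      ∑ b ∈ B, ∑ i, N.obj.map (g b i).op (h.hom.app (op b) (M.obj.map (f b i).op m)) := by
  rw [map_sum, AddMonoidHom.finsetSum_apply]
  refine Finset.sum_congr rfl fun b _ => ?_
  rw [map_sum, AddMonoidHom.finsetSum_apply]
  exact Finset.sum_congr rfl fun i _ => evalHom_homTmul φ h (f b i) (g b i) m

theorem evalHom₃_sum_homTmul₃ {M N L : RightMod S}
    (h : (restrictScalars φ).obj M ⟶ (restrictScalars φ).obj N)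
    (k : (restrictScalars φ).obj N ⟶ (restrictScalars φ).obj L)
    (w : ∀ b : R, Fin (n b) → HomTensor φ x (φ.obj b)) (m : M.obj.obj (op x)) :
    evalHom₃ φ h k x y (∑ b ∈ B, ∑ i, homTmul₃ φ (w b i) (g b i)) m =
      ∑ b ∈ B, ∑ i, L.obj.map (g b i).op
        (k.hom.app (op b) (evalHom φ h x (φ.obj b) (w b i) m)) := by
  rw [map_sum, AddMonoidHom.finsetSum_apply]
  refine Finset.sum_congr rfl fun b _ => ?_
  rw [map_sum, AddMonoidHom.finsetSum_apply]
  exact Finset.sum_congr rfl fun i _ => evalHom₃_homTmul₃ φ h k (w b i) (g b i) m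

end Sums

/-! ### From a family of elements to a heavy splitting. -/

/-- An `S`-linear `α` commutes with `M(f)`, so each term collapses to the action of `f ∘ g`; with
(2) the total action is the identity. -/
theorem evalHom_restrictScalars_map (φ : R ⥤ S) [φ.Additive] {M N : RightMod S} (α : M ⟶ N)
    {x y : S} (w : HomTensor φ x y) (m : M.obj.obj (op x)) :
    evalHom φ ((restrictScalars φ).map α) x y w m =
      N.obj.map ((homCounit φ x).hom.app (op y) w : y ⟶ x).op (α.hom.app (op x) m) := by
  have := N.property
  refine DFunLike.congr_fun
    (f := (AddMonoidHom.eval m).comp (evalHom φ ((restrictScalars φ).map α) x y))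
    -- Additivity of the right side in `w` is obtained by writing it as the counit followed by the
    -- Yoneda map of `α(m)`.
    (g := ((rightHomDesc N (α.hom.app (op x) m)).hom.app (op y)).hom.comp
      ((homCounit φ x).hom.app (op y)).hom) ?_ w
  apply Tensor.addHom_ext
  intro b f g
  refine (evalHom_homTmul φ ((restrictScalars φ).map α) (b := b) f g m).trans ?_
  refine Eq.trans ?_ (congrArg (fun z : y ⟶ x => N.obj.map z.op (α.hom.app (op x) m))
    (homCounit_homTmul φ (b := b) f g)).symm
  refine (congrArg (N.obj.map (Quiver.Hom.op g))
    (ConcreteCategory.congr_hom (α.hom.naturality (Quiver.Hom.op f)) m)).trans ?_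
  exact (ConcreteCategory.congr_hom
    (N.obj.map_comp (Quiver.Hom.op f) (Quiver.Hom.op g)) (α.hom.app (op x) m)).symm

/-- The outer maps are `S`-linear, so they slide past `f` and `g` term by term, for an arbitrary
tensor `w`. -/
theorem evalHom_comp_comp (φ : R ⥤ S) [φ.Additive] {M M' N N' : RightMod S} (α : M ⟶ M')
    (h : (restrictScalars φ).obj M' ⟶ (restrictScalars φ).obj N') (β : N' ⟶ N)
    {x y : S} (w : HomTensor φ x y) (m : M.obj.obj (op x)) :
    evalHom φ ((restrictScalars φ).map α ≫ h ≫ (restrictScalars φ).map β) x y w m =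
      β.hom.app (op y) (evalHom φ h x y w (α.hom.app (op x) m)) := by
  refine DFunLike.congr_fun
    (f := (AddMonoidHom.eval m).comp
      (evalHom φ ((restrictScalars φ).map α ≫ h ≫ (restrictScalars φ).map β) x y))
    (g := (β.hom.app (op y)).hom.comp
      ((AddMonoidHom.eval (α.hom.app (op x) m)).comp (evalHom φ h x y))) ?_ w
  apply Tensor.addHom_ext
  intro b f g
  refine (evalHom_homTmul φ _ (b := b) f g m).trans ?_
  refine Eq.trans ?_ (congrArg (β.hom.app (op y))
    (evalHom_homTmul φ h (b := b) f g (α.hom.app (op x) m))).symm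
  have e1 := ConcreteCategory.congr_hom (α.hom.naturality (Quiver.Hom.op f)) m
  have e2 := ConcreteCategory.congr_hom (β.hom.naturality (Quiver.Hom.op g))
    (h.hom.app (op b) (M'.obj.map (Quiver.Hom.op f) (α.hom.app (op x) m)))
  refine Eq.trans ?_ e2.symm
  exact congrArg (fun z => N.obj.map (Quiver.Hom.op g)
    (β.hom.app (op (φ.obj b)) (h.hom.app (op b) z))) e1

/-- Counterpart of `evalHom_mapRight` on the first factor; together they turn the two sides of (1)
into the two sides of a naturality square. -/
theorem evalHom_precomp (φ : R ⥤ S) [φ.Additive] {M N : RightMod S}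
    (h : (restrictScalars φ).obj M ⟶ (restrictScalars φ).obj N) {x x' y : S} (t : x ⟶ x')
    (w : HomTensor φ x y) (m : M.obj.obj (op x')) :
    evalHom φ h x' y (Tensor.mapLeft (leftHom φ y)
        ((restrictScalars φ).map (rightHomDesc (rightHom x') t)) w) m =
      evalHom φ h x y w (M.obj.map t.op m) := by
  refine DFunLike.congr_fun
    (f := ((AddMonoidHom.eval m).comp (evalHom φ h x' y)).comp (Tensor.mapLeft (leftHom φ y)
      ((restrictScalars φ).map (rightHomDesc (rightHom x') t))))
    (g := (AddMonoidHom.eval (M.obj.map t.op m)).comp (evalHom φ h x y)) ?_ w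
  apply Tensor.addHom_ext
  intro b f g
  refine (congrArg (fun z => evalHom φ h x' y z m) (Tensor.mapLeft_tmul (leftHom φ y)
    ((restrictScalars φ).map (rightHomDesc (rightHom x') t)) b f g)).trans ?_
  refine (evalHom_homTmul φ h (b := b) (Quiver.Hom.unop (Quiver.Hom.op f) ≫ t) g m).trans ?_
  refine Eq.trans ?_ (evalHom_homTmul φ h (b := b) f g (M.obj.map t.op m)).symm
  exact congrArg (fun z => N.obj.map (Quiver.Hom.op g) (h.hom.app (op b) z))
    (ConcreteCategory.congr_hom (M.obj.map_comp t.op (Quiver.Hom.op f)) m)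

variable (φ : R ⥤ S) [φ.Additive] (ξ : T ⥤ S) [ξ.Additive]

/-- The transformation `h ↦ ∑ N(g) ∘ h ∘ M(f)` defined by a natural family of elements
`∑ f ⊗ g`. -/
def splittingApp (Γ : ∀ a : T, HomTensor φ (ξ.obj a) (ξ.obj a))
    (hΓ : ∀ {c a : T} (t : c ⟶ a),
      Tensor.mapLeft (leftHom φ (ξ.obj c))
          ((restrictScalars φ).map (rightHomDesc (rightHom (ξ.obj a)) (ξ.map t))) (Γ c) =
        Tensor.mapRight _ (leftHomMap φ (ξ.map t)) (Γ a))
    {M N : RightMod S} (h : (restrictScalars φ).obj M ⟶ (restrictScalars φ).obj N) :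
    (restrictScalars ξ).obj M ⟶ (restrictScalars ξ).obj N :=
  ObjectProperty.homMk
    { app := fun a => AddCommGrpCat.ofHom
        (evalHom φ h (ξ.obj a.unop) (ξ.obj a.unop) (Γ a.unop))
      naturality := fun a c t => by
        apply AddCommGrpCat.hom_ext
        ext m
        refine (evalHom_precomp φ h (ξ.map t.unop) (Γ c.unop) m).symm.trans ?_
        rw [hΓ t.unop]
        exact evalHom_mapRight φ h (ξ.map t.unop) (Γ a.unop) m }

variable {φ} in
theorem evalHom_comp_of_heavy {x : S} (B : Finset R) (n : R → ℕ)
    (f : ∀ b : R, Fin (n b) → (φ.obj b ⟶ x)) (g : ∀ b : R, Fin (n b) → (x ⟶ φ.obj b))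
    (H : ∑ d ∈ B, ∑ k, homTmul₃ φ (∑ b ∈ B, ∑ i, homTmul φ (f b i) (f d k ≫ g b i)) (g d k) =
      ∑ b ∈ B, ∑ i, homTmul₃ φ (homTmul φ (f b i) (𝟙 (φ.obj b))) (g b i))
    {M N L : RightMod S}
    (h : (restrictScalars φ).obj M ⟶ (restrictScalars φ).obj N)
    (k : (restrictScalars φ).obj N ⟶ (restrictScalars φ).obj L) (m : M.obj.obj (op x)) :
    evalHom φ (h ≫ k) x x (∑ b ∈ B, ∑ i, homTmul φ (f b i) (g b i)) m =
      evalHom φ k x x (∑ b ∈ B, ∑ i, homTmul φ (f b i) (g b i))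
        (evalHom φ h x x (∑ b ∈ B, ∑ i, homTmul φ (f b i) (g b i)) m) := by
  -- Evaluating (3) on the pair `h`, `k` gives both sides of the claim: in `(f ⊗ 1) ⊗ g` nothing
  -- separates `h` from `k`, while the double sum applies `k` after the full evaluation of `h`.
  have e := congrArg (fun w => evalHom₃ φ h k x x w m) H
  simp only [evalHom₃_sum_homTmul₃] at e
  rw [evalHom_sum_homTmul B f g (h ≫ k), evalHom_sum_homTmul B f g k]
  refine Eq.trans ?_ (e.symm.trans ?_)
  · refine Finset.sum_congr rfl fun b _ => Finset.sum_congr rfl fun i _ => ?_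
    refine congrArg (fun z => L.obj.map (g b i).op (k.hom.app (op b) z)) ?_
    refine Eq.symm ((evalHom_homTmul φ h (f b i) (𝟙 (φ.obj b)) m).trans ?_)
    exact ConcreteCategory.congr_hom (N.obj.map_id (op (φ.obj b))) _
  · refine Finset.sum_congr rfl fun d _ => Finset.sum_congr rfl fun j _ => ?_
    refine congrArg (fun z => L.obj.map (g d j).op (k.hom.app (op d) z)) ?_
    -- The inner sum is the whole tensor acted on by `f d j`, which becomes the factor `N(f d j)` in
    -- front of `k`.
    rw [← mapRight_sum_homTmul B f g (f d j)]
    exact evalHom_mapRight φ h (f d j) _ m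

end

end HeavySep

open HeavySep in
theorem mainTheorem5 {R S T : Type u} [SmallCategory R] [Preadditive R]
    [SmallCategory S] [Preadditive S] [SmallCategory T] [Preadditive T]
    (φ : R ⥤ S) [φ.Additive] (ξ : T ⥤ S) [ξ.Additive] :
    HeavySep.IsHeavilySeparable (HeavySep.restrictScalars φ) (HeavySep.restrictScalars ξ) ↔
      ∃ (Γ : ∀ a : T, HeavySep.HomTensor φ (ξ.obj a) (ξ.obj a))
        (B : T → Finset R) (n : T → R → ℕ)
        (f : ∀ (a : T) (b : R), Fin (n a b) → (φ.obj b ⟶ ξ.obj a))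
        (g : ∀ (a : T) (b : R), Fin (n a b) → (ξ.obj a ⟶ φ.obj b)),
        (∀ a : T, Γ a = ∑ b ∈ B a, ∑ i, HeavySep.homTmul φ (f a b i) (g a b i)) ∧
        (∀ (c a : T) (t : c ⟶ a),
          ∑ b ∈ B c, ∑ i, HeavySep.homTmul φ (f c b i ≫ ξ.map t) (g c b i) =
            ∑ b ∈ B a, ∑ i, HeavySep.homTmul φ (f a b i) (ξ.map t ≫ g a b i)) ∧
        (∀ a : T, ∑ b ∈ B a, ∑ i, (g a b i ≫ f a b i) = 𝟙 (ξ.obj a)) ∧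
        (∀ a : T,
          ∑ d ∈ B a, ∑ k, HeavySep.homTmul₃ φ
              (∑ b ∈ B a, ∑ i, HeavySep.homTmul φ (f a b i) (f a d k ≫ g a b i)) (g a d k) =
            ∑ b ∈ B a, ∑ i, HeavySep.homTmul₃ φ
              (HeavySep.homTmul φ (f a b i) (𝟙 (φ.obj b))) (g a b i)) := by
  constructor
  · rintro ⟨P⟩
    choose B n f g hΓ using fun a => HomTensor.exists_eq_sum (splittingElement P a)
    refine ⟨splittingElement P, B, n, f, g, hΓ, fun c a t => ?_, fun a => ?_, fun a => ?_⟩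
    · have h := splittingElement_naturality P t
      rw [hΓ c, hΓ a, mapLeft_sum_homTmul, mapRight_sum_homTmul] at h
      exact h
    · have h := homCounit_splittingElement P a
      rw [hΓ a] at h
      exact (homCounit_sum_homTmul (B a) (f a) (g a)).symm.trans h
    · have h := splittingElement_heavy P a
      rw [hΓ a, mapLeft_sum_homTmul, mapLeft_sum_homTmul] at h
      refine Eq.trans ?_ h
      refine Finset.sum_congr rfl fun d _ => Finset.sum_congr rfl fun k _ => ?_
      -- The Yoneda map of `Γ_a` sends `f a d k` to `Γ_a` acted on by `f a d k`, which is the inner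
      -- sum of (3).
      exact congrArg (fun w => homTmul₃ φ w (g a d k))
        (mapRight_sum_homTmul (B a) (f a) (g a) (f a d k)).symm
  · rintro ⟨Γ, B, n, f, g, hΓ, h1, h2, h3⟩
    have hnat : ∀ {c a : T} (t : c ⟶ a),
        Tensor.mapLeft (leftHom φ (ξ.obj c))
            ((restrictScalars φ).map (rightHomDesc (rightHom (ξ.obj a)) (ξ.map t))) (Γ c) =
          Tensor.mapRight _ (leftHomMap φ (ξ.map t)) (Γ a) := by
      intro c a t
      rw [hΓ c, hΓ a]
      exact (mapLeft_sum_homTmul (B c) (f c) (g c) _).trans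
        ((h1 c a t).trans (mapRight_sum_homTmul (B a) (f a) (g a) (ξ.map t)).symm)
    refine ⟨⟨fun M N h => splittingApp φ ξ Γ hnat h, fun α β h => ?_, fun {M N} α => ?_,
      fun h k => ?_⟩⟩
    · apply ObjectProperty.hom_ext
      ext a m
      exact evalHom_comp_comp φ α h β (Γ a.unop) m
    · apply ObjectProperty.hom_ext
      ext a m
      refine (evalHom_restrictScalars_map φ α (Γ a.unop) m).trans ?_
      have e : (homCounit φ (ξ.obj a.unop)).hom.app (op (ξ.obj a.unop)) (Γ a.unop) =
          𝟙 (ξ.obj a.unop) := by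
        rw [hΓ]
        exact (homCounit_sum_homTmul _ _ _).trans (h2 a.unop)
      refine (congrArg (fun z : ξ.obj a.unop ⟶ ξ.obj a.unop =>
        N.obj.map z.op (α.hom.app (op (ξ.obj a.unop)) m)) e).trans ?_
      exact ConcreteCategory.congr_hom (N.obj.map_id (op (ξ.obj a.unop))) _
    · apply ObjectProperty.hom_ext
      ext a m
      have e := evalHom_comp_of_heavy _ _ _ _ (h3 a.unop) h k m
      rw [← hΓ] at e
      exact e
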